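/- For $n\ge 0$ let $S_n$ be the set of permutations of $[n]=\{1,\dots,n\}$, where $S_0$ contains only the empty permutation $\pi_\emptyset$. A permutation $\pi\in S_n$ is called an ordinary ménage permutation if $\pi(i)\ne i$ and $\pi(i)\not\equiv i+1 \pmod n$ for all $1\le i\le n$; in particular $\pi_\emptyset$ is one. Define two kinds of reductions, each turning a permutation $\pi\in S_n$ ($n\ge1$) into a permutation $\pi'\in S_{n-1}$. Type 1 (removing a fixed point): if $\pi(i)=i$, delete the point $i$ and its arc, and renumber the remaining points in order; that is, for $1\le j\le n-1$, put $\hat\jmath=j$ if $j<i$ and $\hat\jmath=j+1$ if $j\ge i$, and let $\pi'(j)=\pi(\hat\jmath)$ if $\pi(\hat\jmath)<i$ and $\pi'(j)=\pi(\hat\jmath)-1$ if $\pi(\hat\jmath)>i$. Type 3 (gluing a generalized succession): if $\pi(i)\equiv i+1\pmod n$, erase the arc from $i$ to $\pi(i)$ and glue these two points together. Explicitly, if $i\neq n$, then for $1\le j\le n-1$, with $\hat\jmath$ as above, $\pi'(j)=\pi(\hat\jmath)$ if $\pi(\hat\jmath)\le i$ and $\pi'(j)=\pi(\hat\jmath)-1$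 if $\pi(\hat\jmath)>i+1$; if $i=n>1$, then $\pi'(j)=\pi(j)$ for $j\ne\pi^{-1}(n)$ and $\pi'(j)=1$ for $j=\pi^{-1}(n)$; if $i=n=1$, then $\pi'=\pi_\emptyset$. Let $C_k=\frac{(2k)!}{k!\,(k+1)!}$ be the $k$th Catalan number and let $c(x)=\sum_{k\ge0}C_kx^k$. Theorem. Let $m\ge0$ and let $\pi\in S_m$ be an ordinary ménage permutation. For $n\ge0$ let $r_m^n$ be the number of permutations $\tau\in S_{m+n}$ that can be reduced to $\pi$ by a (possibly empty) series of reductions of type 1 and type 3. Then, as formal power series, $$\sum_{n\ge0}r_m^n x^n=\begin{cases}c'(x)\,c(x)^{2m-2}&\text{if } m>0,\\ c(x)&\text{if } m=0.\end{cases}$$ -/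

import Mathlib

namespace Menage

/- Permutations of `[n] = {1, ..., n}` are represented as `Equiv.Perm (Fin n)`; the label
`p ∈ {1, ..., n}` corresponds to the element `p - 1` of `Fin n`. -/

/-- `i` starts a generalized succession of `π ∈ S_n`: `π(i) ≡ i + 1 (mod n)`. -/
def IsGenSucc {n : ℕ} (π : Equiv.Perm (Fin n)) (i : Fin n) : Prop :=
  (π i : ℕ) ≡ (i : ℕ) + 1 [MOD n]

/-- Ordinary ménage permutations: no fixed points and no generalized successions. The empty
permutation is one of them. -/
def IsOrdinaryMenage {n : ℕ} (π : Equiv.Perm (Fin n)) : Prop :=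
  ∀ i : Fin n, π i ≠ i ∧ ¬ IsGenSucc π i

/-- Relabelling of the values when the point `i` is deleted: the values after `i` are shifted
down by one. -/
def removeLabel (i v : ℕ) : ℕ := if v < i then v else v - 1

/-- Relabelling of the values when the points `i` and `i + 1` (cyclically) of `{0, ..., n}` are
glued together: if `i` is not the last point `n`, the values after `i` are shifted down by one
(so that `i` and `i + 1` both become `i`); if `i = n`, then `n` becomes `0` and the other labels
are unchanged. -/
def glueLabel (n i v : ℕ) : ℕ :=
  if i = n then (if v = n then 0 else v) else (if v ≤ i then v else v - 1)

/-- `π'` is obtained from `π` by the reduction of type 1 that removes the fixed point `i`.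
Here `i.succAbove j` is `j` for `j < i` and `j + 1` for `j ≥ i`. -/
def IsRemoveFixedPoint {n : ℕ} (π : Equiv.Perm (Fin (n + 1))) (i : Fin (n + 1))
    (π' : Equiv.Perm (Fin n)) : Prop :=
  π i = i ∧ ∀ j : Fin n, (π' j : ℕ) = removeLabel i (π (i.succAbove j))

/-- `π'` is obtained from `π` by the reduction of type 3 that glues together the generalized
succession formed by `i` and `i + 1 (mod n + 1)`: the arc from `i` to `i + 1` is erased, and the
glued point keeps the outgoing arc of `i + 1` and the incoming arc of `i`. -/
def IsGlueGenSucc {n : ℕ} (π : Equiv.Perm (Fin (n + 1))) (i : Fin (n + 1))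
    (π' : Equiv.Perm (Fin n)) : Prop :=
  IsGenSucc π i ∧ ∀ j : Fin n, (π' j : ℕ) = glueLabel n i (π (i.succAbove j))

/-- One reduction of type 1 or type 3. -/
inductive Step : (Σ n, Equiv.Perm (Fin n)) → (Σ n, Equiv.Perm (Fin n)) → Prop
  | removeFixedPoint {n : ℕ} (π : Equiv.Perm (Fin (n + 1))) (i : Fin (n + 1))
      (π' : Equiv.Perm (Fin n)) (h : IsRemoveFixedPoint π i π') : Step ⟨n + 1, π⟩ ⟨n, π'⟩
  | glueGenSucc {n : ℕ} (π : Equiv.Perm (Fin (n + 1))) (i : Fin (n + 1))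
      (π' : Equiv.Perm (Fin n)) (h : IsGlueGenSucc π i π') : Step ⟨n + 1, π⟩ ⟨n, π'⟩

/-- `τ` can be reduced to `π` by a (possibly empty) series of reductions of type 1 and type 3. -/
def CanReduce {k m : ℕ} (τ : Equiv.Perm (Fin k)) (π : Equiv.Perm (Fin m)) : Prop :=
  Relation.ReflTransGen Step ⟨k, τ⟩ ⟨m, π⟩

/-- The number `r_m^n` of permutations in `S_{m+n}` that can be reduced to `π ∈ S_m`. -/
noncomputable def reductionCount {m : ℕ} (π : Equiv.Perm (Fin m)) (n : ℕ) : ℕ :=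
  Nat.card {τ : Equiv.Perm (Fin (m + n)) // CanReduce τ π}

end Menage

/-! ### Inserting a pair of adjacent points into a circle. -/

namespace Menage

/-! Split each point into the end of its incoming arc and the start of its outgoing arc: a
permutation of `N` points becomes a parity-changing perfect matching of a circle of `2N` points
(`diagram`). Fixed points and generalized successions become the chords joining adjacent points, and
both reductions delete such a short chord (`step_iff`). So `r_m^n` counts the diagrams obtained from
that of `π` by `n` insertions of short chords.

Mark the second end of each inserted chord. As in matching parentheses around a circle, the marks
determine the diagram, and every set of `n` marks occurs (`existsUnique_arises_of_card`); this gives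
`(2 * (m + n)).choose n` marked diagrams. If `m > 0`, the diagram of `π` has no short chord and the
marks can be read off the final diagram (`Arises.mark_unique`), so this number is `r_m^n`. If `m =
0`, the diagrams are noncrossing and each has `n + 1` markings, as many as the regions it cuts out
of the disc (`ncard_marks`), so `r_0^n` is a Catalan number.

Finally, let `B_a = ∑ (a + 2n).choose n * x^n`. Pascal's rule and `c = 1 + x c²` give `B_2 = c'` and
`B_{a+2} = c B_{a+1}`, hence `B_{2m} = c' c^(2m-2)` for `m > 0`. -/

/-- The cyclic successor on `Fin N`. -/
def nx {N : ℕ} (x : Fin N) : Fin N :=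
  ⟨if (x : ℕ) + 1 = N then 0 else x + 1, by have := x.2; split_ifs <;> omega⟩

/-- The relabelling of a circle of `2k` points when a pair of adjacent points is inserted so that
it occupies the positions `p` and `nx p`. -/
def emb {k : ℕ} (p : Fin (2 * (k + 1))) (x : Fin (2 * k)) : Fin (2 * (k + 1)) :=
  ⟨if (p : ℕ) = 2 * k + 1 then (if (x : ℕ) = 0 then 2 * k else x)
    else (if (x : ℕ) < p then x else x + 2), by have := x.2; split_ifs <;> omega⟩

theorem val_nx {N : ℕ} (x : Fin N) : (nx x : ℕ) = if (x : ℕ) + 1 = N then 0 else (x : ℕ) + 1 := rfl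

theorem val_emb {k : ℕ} (p : Fin (2 * (k + 1))) (x : Fin (2 * k)) :
    (emb p x : ℕ) = if (p : ℕ) = 2 * k + 1 then (if (x : ℕ) = 0 then 2 * k else x)
    else (if (x : ℕ) < p then x else x + 2) := rfl

theorem nx_ne {k : ℕ} (p : Fin (2 * (k + 1))) : nx p ≠ p := by
  intro h
  have h := congrArg Fin.val h
  rw [val_nx] at h
  split_ifs at h <;> omega

theorem emb_injective {k : ℕ} (p : Fin (2 * (k + 1))) : Function.Injective (emb p) := by
  intro x y h
  have h := congrArg Fin.val h
  have := x.2
  have := y.2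
  ext
  rw [val_emb, val_emb] at h
  split_ifs at h <;> omega

theorem emb_ne {k : ℕ} (p : Fin (2 * (k + 1))) (x : Fin (2 * k)) : emb p x ≠ p := by
  intro h
  have h := congrArg Fin.val h
  have := x.2
  rw [val_emb] at h
  split_ifs at h <;> omega

theorem emb_ne_nx {k : ℕ} (p : Fin (2 * (k + 1))) (x : Fin (2 * k)) : emb p x ≠ nx p := by
  intro h
  have h := congrArg Fin.val h
  have := x.2
  rw [val_emb, val_nx] at h
  split_ifs at h <;> omega

theorem eq_or_eq_nx_or_emb {k : ℕ} (p y : Fin (2 * (k + 1))) :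
    y = p ∨ y = nx p ∨ ∃ x, emb p x = y := by
  by_contra! h
  obtain ⟨h1, h2, h3⟩ := h
  have h1 : (y : ℕ) ≠ p := fun h => h1 (Fin.ext h)
  have h2 : (y : ℕ) ≠ nx p := fun h => h2 (Fin.ext h)
  rw [val_nx] at h2
  have hy := y.2
  have hp := p.2
  by_cases hw : (p : ℕ) = 2 * k + 1
  · by_cases hk : (y : ℕ) = 2 * k
    · have : 0 < k := by
        by_contra h0
        split_ifs at h2 <;> omega
      refine h3 ⟨0, by omega⟩ (Fin.ext ?_)
      rw [val_emb, if_pos hw, if_pos rfl, hk]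
    · refine h3 ⟨y, by omega⟩ (Fin.ext ?_)
      rw [val_emb, if_pos hw, if_neg]
      rw [if_pos (by omega)] at h2
      exact h2
  · rw [if_neg (by omega)] at h2
    by_cases hl : (y : ℕ) < p
    · refine h3 ⟨y, by omega⟩ (Fin.ext ?_)
      rw [val_emb, if_neg hw, if_pos hl]
    · refine h3 ⟨y - 2, by omega⟩ (Fin.ext ?_)
      rw [val_emb, if_neg hw, if_neg (by simp; omega)]
      simp
      omega

theorem nx_nx_ne {k : ℕ} (hk : 0 < k) (p : Fin (2 * (k + 1))) : nx (nx p) ≠ p := by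
  intro h
  have h := congrArg Fin.val h
  rw [val_nx, val_nx] at h
  split_ifs at h <;> omega

/-- On two points the only chord is short from either end; this degenerate circle is the source of
the exceptional behaviour for `m = 0`. -/
theorem nx_nx_two (p : Fin (2 * (0 + 1))) : nx (nx p) = p := by
  ext
  have := p.2
  rw [val_nx, val_nx]
  split_ifs <;> omega

theorem nx_injective {N : ℕ} : Function.Injective (nx : Fin N → Fin N) := by
  intro x y h
  have h := congrArg Fin.val h
  ext
  have := x.2
  have := y.2
  rw [val_nx, val_nx] at h
  split_ifs at h <;> omega

/-- Two disjoint pairs of adjacent points can be inserted in either order. -/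
theorem exists_emb_comm {k : ℕ} (p q : Fin (2 * (k + 1 + 1))) (h : q ≠ p) (h1 : q ≠ nx p)
    (h2 : p ≠ nx q) :
    ∃ q' p' : Fin (2 * (k + 1)), emb p q' = q ∧ emb p (nx q') = nx q ∧ emb q p' = p ∧
      emb q (nx p') = nx p ∧ ∀ x, emb p (emb q' x) = emb q (emb p' x) := by
  wlog hpq : p < q generalizing p q
  · obtain ⟨a, b, h1, h2, h3, h4, h5⟩ := this q p h.symm h2 h1
      (lt_of_le_of_ne (not_lt.1 hpq) h)
    exact ⟨b, a, h3, h4, h1, h2, fun x => (h5 x).symm⟩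
  have hp := p.2
  have hq := q.2
  have h1 : (q : ℕ) ≠ nx p := fun h => h1 (Fin.ext h)
  have h2 : (p : ℕ) ≠ nx q := fun h => h2 (Fin.ext h)
  have hpq : (p : ℕ) < q := hpq
  rw [val_nx] at h1 h2
  rw [if_neg (by omega)] at h1
  have hp' : (p : ℕ) < 2 * (k + 1) := by split_ifs at h2 <;> omega
  have e1 : ¬ (p : ℕ) = 2 * (k + 1) + 1 := by omega
  have e2 : ¬ (p : ℕ) + 1 = 2 * (k + 1 + 1) := by omega
  -- Since `p < q` and `q ≠ nx p`, taking out the pair at `p` lowers `q` by two, while taking out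
  -- the pair at `q` does not move `p`.
  obtain ⟨q', hq'⟩ : ∃ q' : Fin (2 * (k + 1)), (q : ℕ) = q' + 2 := ⟨⟨q - 2, by omega⟩, by simp; omega⟩
  obtain ⟨p', hp''⟩ : ∃ p' : Fin (2 * (k + 1)), (p' : ℕ) = p := ⟨⟨p, by omega⟩, rfl⟩
  refine ⟨q', p', ?_, ?_, ?_, ?_, fun x => ?_⟩
  · ext
    rw [val_emb, if_neg e1, if_neg (by omega), hq']
  · ext
    rw [val_emb, if_neg e1, val_nx, val_nx]
    split_ifs at * <;> omega
  · ext
    rw [val_emb]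
    split_ifs at * <;> omega
  · ext
    rw [val_emb, val_nx, val_nx, hp'', if_neg e2]
    split_ifs at * <;> omega
  · ext
    have hx := x.2
    -- If `q` is the last point, its pair wraps around and occupies `0`; then `p ≠ nx q` gives `p ≠
    -- 0`.
    by_cases hw : (q : ℕ) = 2 * (k + 1) + 1
    · rw [if_pos (by omega)] at h2
      have e3 : (q' : ℕ) = 2 * k + 1 := by omega
      rw [val_emb, if_neg e1, val_emb, if_pos e3, val_emb, if_pos hw, val_emb]
      rw [hp'']
      by_cases hx0 : (x : ℕ) = 0 <;> by_cases hw' : (p : ℕ) = 2 * k + 1 <;>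
        by_cases hxp : (x : ℕ) < p <;> simp only [hx0, hw', hxp, if_true, if_false] <;>
        split_ifs at * <;> omega
    · have e3 : ¬ (q' : ℕ) = 2 * k + 1 := by omega
      rw [val_emb, if_neg e1, val_emb, if_neg e3, val_emb, if_neg hw, val_emb, hp'', hq']
      rw [if_neg (show ¬ (p : ℕ) = 2 * k + 1 by omega)]
      split_ifs <;> omega

end Menage
-- Inserting chords and marks.
namespace Menage

/-- The function on `2(k+1)` points with the values `a` and `b` at `p` and `nx p` and the values of
`g` at the other points. -/
noncomputable def extend {α : Type*} {k : ℕ} (p : Fin (2 * (k + 1))) (a b : α)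
    (g : Fin (2 * k) → α) (y : Fin (2 * (k + 1))) : α :=
  open Classical in
  -- The final `a` is never taken, by `eq_or_eq_nx_or_emb`.
  if y = p then a else if y = nx p then b else if h : ∃ x, emb p x = y then g h.choose else a

section extend

variable {α : Type*} {k : ℕ} (p : Fin (2 * (k + 1))) (a b : α) (g : Fin (2 * k) → α)

@[simp] theorem extend_self : extend p a b g p = a := by simp [extend]

@[simp] theorem extend_nx : extend p a b g (nx p) = b := by simp [extend, nx_ne]

@[simp] theorem extend_emb (x : Fin (2 * k)) : extend p a b g (emb p x) = g x := by
  have h : ∃ y, emb p y = emb p x := ⟨x, rfl⟩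
  rw [extend, if_neg (emb_ne p x), if_neg (emb_ne_nx p x), dif_pos h,
    emb_injective p h.choose_spec]

variable {p a b g}

theorem eq_extend {G : Fin (2 * (k + 1)) → α} (h1 : G p = a) (h2 : G (nx p) = b)
    (h3 : ∀ x, G (emb p x) = g x) : G = extend p a b g := by
  funext y
  obtain rfl | rfl | ⟨x, rfl⟩ := eq_or_eq_nx_or_emb p y
  · simp [h1]
  · simp [h2]
  · simp [h3]

theorem extend_injective : Function.Injective (extend p a b) := by
  intro g g' h
  funext x
  simpa using congrFun h (emb p x)

end extend

/-- Insertion of a chord joining two new adjacent points `p` and `nx p` into a chord diagram, given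
by the function that maps each point to its partner. -/
noncomputable def addChord {k : ℕ} (p : Fin (2 * (k + 1))) (f : Fin (2 * k) → Fin (2 * k)) :
    Fin (2 * (k + 1)) → Fin (2 * (k + 1)) :=
  extend p (nx p) p fun x => emb p (f x)

theorem addChord_injective {k : ℕ} (p : Fin (2 * (k + 1))) : Function.Injective (addChord p) := by
  intro f g h
  have h := extend_injective h
  funext x
  exact emb_injective p (congrFun h x)

/-- The points `p` and `nx p` are joined by a chord. -/
def IsShort {N : ℕ} (f : Fin N → Fin N) (p : Fin N) : Prop := f p = nx p ∧ f (nx p) = p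

theorem isShort_addChord {k : ℕ} (p : Fin (2 * (k + 1))) (f : Fin (2 * k) → Fin (2 * k)) :
    IsShort (addChord p f) p := by simp [IsShort, addChord]

/-- The hypotheses say that the new pair is not inserted between `q'` and `nx q'`, so the two points
stay adjacent. -/
theorem isShort_addChord_emb {k : ℕ} {p q : Fin (2 * (k + 1 + 1))} {q' : Fin (2 * (k + 1))}
    (h : emb p q' = q) (h' : emb p (nx q') = nx q) (f : Fin (2 * (k + 1)) → Fin (2 * (k + 1))) :
    IsShort (addChord p f) q ↔ IsShort f q' := by
  rw [IsShort, IsShort, ← h', ← h]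
  simp only [addChord, extend_emb, (emb_injective p).eq_iff]

/-- Insertion of an opening point `p` and a closing point `nx p` into a set of closing points. -/
noncomputable def addMark {k : ℕ} (p : Fin (2 * (k + 1))) (s : Fin (2 * k) → Bool) :
    Fin (2 * (k + 1)) → Bool :=
  extend p false true s

theorem extend_comm {α : Type*} {k : ℕ} {p q : Fin (2 * (k + 1 + 1))} {q' p' : Fin (2 * (k + 1))}
    (h1 : emb p q' = q) (h2 : emb p (nx q') = nx q) (h3 : emb q p' = p) (h4 : emb q (nx p') = nx p)
    (h5 : ∀ x, emb p (emb q' x) = emb q (emb p' x)) (a b c d : α) (g : Fin (2 * k) → α) :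
    extend p a b (extend q' c d g) = extend q c d (extend p' a b g) := by
  refine eq_extend ?_ ?_ fun x => ?_
  · simp [← h1]
  · simp [← h2]
  · obtain rfl | rfl | ⟨y, rfl⟩ := eq_or_eq_nx_or_emb p' x
    · simp [h3]
    · simp [h4]
    · simp [← h5]

theorem addMark_comm {k : ℕ} {p q : Fin (2 * (k + 1 + 1))} {q' p' : Fin (2 * (k + 1))}
    (h1 : emb p q' = q) (h2 : emb p (nx q') = nx q) (h3 : emb q p' = p) (h4 : emb q (nx p') = nx p)
    (h5 : ∀ x, emb p (emb q' x) = emb q (emb p' x)) (s : Fin (2 * k) → Bool) :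
    addMark p (addMark q' s) = addMark q (addMark p' s) :=
  extend_comm h1 h2 h3 h4 h5 ..

theorem addChord_comm {k : ℕ} {p q : Fin (2 * (k + 1 + 1))} {q' p' : Fin (2 * (k + 1))}
    (h1 : emb p q' = q) (h2 : emb p (nx q') = nx q) (h3 : emb q p' = p) (h4 : emb q (nx p') = nx p)
    (h5 : ∀ x, emb p (emb q' x) = emb q (emb p' x)) (f : Fin (2 * k) → Fin (2 * k)) :
    addChord p (addChord q' f) = addChord q (addChord p' f) := by
  have key : ∀ {p q : Fin (2 * (k + 1 + 1))} {q' : Fin (2 * (k + 1))},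
      emb p q' = q → emb p (nx q') = nx q →
      (fun x => emb p (addChord q' f x)) = extend q' (nx q) q fun x => emb p (emb q' (f x)) := by
    intro p q q' h1 h2
    refine eq_extend ?_ ?_ fun x => ?_ <;> simp [addChord, h1, h2]
  rw [addChord, key h1 h2, extend_comm h1 h2 h3 h4 h5, addChord, key h3 h4]
  simp only [h5]

/-- `f` arises from the chord diagram `f₀` by `n` insertions of chords joining adjacent points,
and `s` marks the closing points of the inserted chords. -/
def Arises {m : ℕ} (f₀ : Fin (2 * m) → Fin (2 * m)) :
    (n : ℕ) → (Fin (2 * (m + n)) → Fin (2 * (m + n))) → (Fin (2 * (m + n)) → Bool) → Prop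
  | 0, f, s => f = f₀ ∧ s = fun _ => false
  | n + 1, f, s => ∃ (p : Fin (2 * (m + n + 1))) (f' : Fin (2 * (m + n)) → Fin (2 * (m + n)))
      (s' : Fin (2 * (m + n)) → Bool), Arises f₀ n f' s' ∧ f = addChord p f' ∧ s = addMark p s'

variable {m : ℕ} {f₀ : Fin (2 * m) → Fin (2 * m)} {n : ℕ}

theorem Arises.succ {f : Fin (2 * (m + n)) → Fin (2 * (m + n))} {s : Fin (2 * (m + n)) → Bool}
    (h : Arises f₀ n f s) (p : Fin (2 * (m + n + 1))) :
    Arises f₀ (n + 1) (addChord p f) (addMark p s) := ⟨p, f, s, h, rfl, rfl⟩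

/-- An opening point directly followed by a closing point bounds an inserted chord, which may be
taken to be the last one inserted. -/
theorem Arises.of_mark : ∀ {n : ℕ} {f : Fin (2 * (m + n + 1)) → Fin (2 * (m + n + 1))}
    {s : Fin (2 * (m + n + 1)) → Bool}, Arises f₀ (n + 1) f s →
    ∀ {p : Fin (2 * (m + n + 1))}, s p = false → s (nx p) = true →
    ∃ f' s', Arises f₀ n f' s' ∧ f = addChord p f' ∧ s = addMark p s' := by
  intro n
  induction n with
  | zero =>
    rintro f s ⟨q, f', s', h', rfl, rfl⟩ p hp hp'
    obtain rfl | rfl | ⟨x, hx⟩ := eq_or_eq_nx_or_emb q p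
    · exact ⟨f', s', h', rfl, rfl⟩
    · simp [addMark] at hp
    · obtain h | h | ⟨y, hy⟩ := eq_or_eq_nx_or_emb q (nx p)
      · simp [addMark, h] at hp'
      · exact absurd (nx_injective h ▸ hx) (emb_ne _ _)
      · rw [← hy] at hp'
        simp [addMark, h'.2] at hp'
  | succ n ih =>
    rintro f s ⟨q, f', s', h', rfl, rfl⟩ p hp hp'
    by_cases hqp : q = p
    · subst hqp
      exact ⟨f', s', h', rfl, rfl⟩
    have h1 : q ≠ nx p := by
      rintro rfl
      simp [addMark] at hp'
    have h2 : p ≠ nx q := by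
      rintro rfl
      simp [addMark] at hp
    -- The pairs at `p` and `q` are disjoint: the pair at `p` comes last in building `f'` by
    -- induction, and then the two insertions are interchanged.
    obtain ⟨q', p', e1, e2, e3, e4, e5⟩ := exists_emb_comm p q hqp h1 h2
    obtain ⟨f'', s'', h'', rfl, rfl⟩ := ih h' (p := p')
      (by simpa [addMark, ← e3] using hp) (by simpa [addMark, ← e4] using hp')
    exact ⟨_, _, h''.succ q', (addChord_comm e1 e2 e3 e4 e5 _).symm,
      (addMark_comm e1 e2 e3 e4 e5 _).symm⟩

/-- The partner of `nx p` would be both `p` and `nx (nx p)`. -/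
theorem isShort_overlap {k : ℕ} {f : Fin (2 * (k + 1)) → Fin (2 * (k + 1))}
    {p : Fin (2 * (k + 1))} (hp : IsShort f p) (hq : IsShort f (nx p)) : k = 0 := by
  by_contra hk
  exact nx_nx_ne (Nat.pos_of_ne_zero hk) p (hq.1.symm.trans hp.2)

/-- Two different short chords of a diagram with more than one chord are disjoint. -/
theorem isShort_disjoint {k : ℕ} (hk : 0 < k) {f : Fin (2 * (k + 1)) → Fin (2 * (k + 1))}
    {p q : Fin (2 * (k + 1))} (hp : IsShort f p) (hq : IsShort f q) : q ≠ nx p ∧ p ≠ nx q := by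
  constructor <;> rintro rfl
  · exact hk.ne' (isShort_overlap hp hq)
  · exact hk.ne' (isShort_overlap hq hp)

/-- The pair of ends of a short chord consists of an opening and a closing point; unless the
original diagram is empty, they come in this order. -/
theorem Arises.mark_of_isShort (h₀ : ∀ p, ¬ IsShort f₀ p) : ∀ {n : ℕ}
    {f : Fin (2 * (m + n + 1)) → Fin (2 * (m + n + 1))} {s : Fin (2 * (m + n + 1)) → Bool},
    Arises f₀ (n + 1) f s → ∀ {p : Fin (2 * (m + n + 1))}, IsShort f p →
    (s p = false ∧ s (nx p) = true) ∨ (m = 0 ∧ s p = true ∧ s (nx p) = false) := by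
  intro n
  induction n with
  | zero =>
    rintro f s ⟨q, f', s', ⟨rfl, rfl⟩, rfl, rfl⟩ p hp
    by_cases hqp : q = p
    · subst hqp
      simp [addMark]
    have hq := isShort_addChord q f'
    rcases Nat.eq_zero_or_pos m with rfl | hm
    -- On the two-point circle the single chord is also short when read from its closing point, in
    -- reversed order.
    · right
      obtain rfl | rfl | ⟨x, hx⟩ := eq_or_eq_nx_or_emb q p
      · exact absurd rfl hqp
      · refine ⟨rfl, by simp [addMark], ?_⟩
        rw [show nx (nx q) = q from nx_nx_two q]
        simp [addMark]
      · exact absurd x.2 (by omega)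
    · obtain ⟨h1, h2⟩ := isShort_disjoint hm hp hq
      obtain ⟨m, rfl⟩ := Nat.exists_eq_succ_of_ne_zero hm.ne'
      obtain ⟨q', p', e1, e2, e3, e4, e5⟩ := exists_emb_comm p q hqp h1 h2
      exact absurd ((isShort_addChord_emb e3 e4 _).1 hp) (h₀ _)
  | succ n ih =>
    rintro f s ⟨q, f', s', h', rfl, rfl⟩ p hp
    by_cases hqp : q = p
    · subst hqp
      simp [addMark]
    obtain ⟨h1, h2⟩ := isShort_disjoint (Nat.succ_pos _) hp (isShort_addChord q f')
    obtain ⟨q', p', e1, e2, e3, e4, e5⟩ := exists_emb_comm p q hqp h1 h2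
    have := ih h' ((isShort_addChord_emb e3 e4 _).1 hp)
    rw [← e4, ← e3]
    simpa [addMark] using this

end Menage
-- Counting marked diagrams and recovering the marks.
namespace Menage
open Finset

theorem exists_nx_of_false_of_true {N : ℕ} {s : Fin N → Bool} {a b : Fin N} (ha : s a = false)
    (hb : s b = true) : ∃ p, s p = false ∧ s (nx p) = true := by
  by_contra! h
  have h : ∀ p, s p = false → s (nx p) = false := fun p hp => by simpa using h p hp
  have up : ∀ c : Fin N, s c = false → ∀ d : ℕ, (hd : d < N) → (c : ℕ) ≤ d → s ⟨d, hd⟩ = false := by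
    intro c hc d hd hcd
    induction d, hcd using Nat.le_induction with
    | base => exact hc
    | succ d _ ih =>
      have h := h _ (ih (by omega))
      have e : nx (⟨d, by omega⟩ : Fin N) = ⟨d + 1, hd⟩ := by
        ext
        rw [val_nx]
        exact if_neg hd.ne
      rwa [e] at h
  have hN : 0 < N := a.pos
  have h0 : s ⟨0, hN⟩ = false := by
    have h := h _ (up a ha (N - 1) (by omega) (by omega))
    have e : nx (⟨N - 1, by omega⟩ : Fin N) = ⟨0, hN⟩ := by
      ext
      rw [val_nx]
      exact if_pos (by simp; omega)
    rwa [e] at h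
  simp [up _ h0 b b.2 (Nat.zero_le _)] at hb

theorem card_addMark {k : ℕ} (p : Fin (2 * (k + 1))) (s : Fin (2 * k) → Bool) :
    #{x | addMark p s x = true} = #{x | s x = true} + 1 := by
  have h : ({x | addMark p s x = true} : Finset _) =
      Finset.cons (nx p) (({x | s x = true} : Finset _).map ⟨emb p, emb_injective p⟩)
        (by simp [emb_ne_nx]) := by
    ext y
    rw [mem_filter_univ, mem_cons, mem_map]
    obtain rfl | rfl | ⟨x, rfl⟩ := eq_or_eq_nx_or_emb p y
    · simp [addMark, emb_ne, (nx_ne _).symm]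
    · simp [addMark]
    · simp [addMark, emb_ne_nx, (emb_injective p).eq_iff]
  rw [h, card_cons, card_map]

variable {m : ℕ} {f₀ : Fin (2 * m) → Fin (2 * m)}

theorem Arises.card_mark : ∀ {n : ℕ} {f : Fin (2 * (m + n)) → Fin (2 * (m + n))}
    {s : Fin (2 * (m + n)) → Bool}, Arises f₀ n f s → #{x | s x = true} = n
  | 0, f, s, h => by simp [h.2]
  | n + 1, f, s, ⟨p, f', s', h', hf, hs⟩ => by
    rw [hs]
    exact (card_addMark p s').trans (congrArg (· + 1) h'.card_mark)

theorem eq_addMark {k : ℕ} {p : Fin (2 * (k + 1))} {s : Fin (2 * (k + 1)) → Bool}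
    (h1 : s p = false) (h2 : s (nx p) = true) : s = addMark p fun x => s (emb p x) :=
  eq_extend h1 h2 fun _ => rfl

/-- Somewhere an unmarked point is followed by a marked one. By `Arises.of_mark` this pair may be
taken as the last insertion of any construction, so its chord is forced; removing the pair leaves
one mark fewer. -/
theorem existsUnique_arises_of_card : ∀ {n : ℕ} {s : Fin (2 * (m + n)) → Bool},
    #{x | s x = true} = n → ∃! f, Arises f₀ n f s := by
  intro n
  induction n with
  | zero =>
    intro s hs
    refine ⟨f₀, ⟨rfl, ?_⟩, fun f hf => hf.1⟩
    funext x
    simpa using filter_eq_empty_iff.1 (card_eq_zero.1 hs) (mem_univ x)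
  | succ n ih =>
    intro s hs
    obtain ⟨b, hb⟩ : ∃ b, s b = true := by
      obtain ⟨b, hb⟩ := card_pos.1 (hs.symm.subst (motive := (0 < ·)) (Nat.succ_pos n))
      exact ⟨b, (mem_filter_univ b).1 hb⟩
    obtain ⟨a, ha⟩ : ∃ a, s a = false := by
      by_contra! h
      rw [filter_true_of_mem fun x _ => by simpa using h x, card_univ, Fintype.card_fin] at hs
      omega
    obtain ⟨p, hp, hp'⟩ := exists_nx_of_false_of_true ha hb
    have hs' := eq_addMark (k := m + n) hp hp'
    obtain ⟨f, hf, hu⟩ := ih (s := fun x => s (emb (k := m + n) p x)) (by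
      rw [hs'] at hs
      exact Nat.succ_injective ((card_addMark _ _).symm.trans hs))
    refine ⟨addChord (k := m + n) p f, ?_, fun g hg => ?_⟩
    · have := hf.succ p
      rwa [← hs'] at this
    · obtain ⟨g', s', h, rfl, rfl⟩ := hg.of_mark hp hp'
      rw [hu g' (by simpa [addMark] using h)]

/-- If the original diagram is not empty and has no short chord, the marks are determined by the
diagram. -/
theorem Arises.mark_unique (hm : 0 < m) (h₀ : ∀ p, ¬ IsShort f₀ p) : ∀ {n : ℕ}
    {f : Fin (2 * (m + n)) → Fin (2 * (m + n))} {s t : Fin (2 * (m + n)) → Bool},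
    Arises f₀ n f s → Arises f₀ n f t → s = t
  | 0, f, s, t, hs, ht => hs.2.trans ht.2.symm
  | n + 1, f, s, t, ⟨p, f', s', h', hf, hs⟩, ht => by
    have hp : IsShort f p := hf ▸ isShort_addChord p f'
    -- As `m > 0`, the marks `t` also orient the short chord at `p` forwards, so both constructions
    -- may end with the same insertion.
    obtain ⟨h1, h2⟩ | ⟨h, -⟩ := ht.mark_of_isShort h₀ hp
    · obtain ⟨f'', t', h'', hf', ht'⟩ := ht.of_mark h1 h2
      obtain rfl := addChord_injective p (hf.symm.trans hf')
      rw [hs, ht', h'.mark_unique hm h₀ h'']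
    · exact absurd h hm.ne'

theorem card_mark_eq (N n : ℕ) :
    Nat.card {s : Fin N → Bool // #{x | s x = true} = n} = N.choose n := by
  let e : {s : Fin N → Bool // #{x | s x = true} = n} ≃ {t : Finset (Fin N) // #t = n} :=
    { toFun := fun s => ⟨({x | s.1 x = true} : Finset _), s.2⟩
      invFun := fun t => ⟨fun x => decide (x ∈ t.1), by simpa using t.2⟩
      left_inv := fun s => by ext; simp
      right_inv := fun t => by ext; simp }
  rw [Nat.card_congr e, Nat.card_eq_fintype_card, Fintype.card_finset_len, Fintype.card_fin]

/-- The number of diagrams with marks. -/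
theorem card_arises (f₀ : Fin (2 * m) → Fin (2 * m)) (n : ℕ) :
    Nat.card {fs : (Fin (2 * (m + n)) → Fin (2 * (m + n))) × (Fin (2 * (m + n)) → Bool) //
      Arises f₀ n fs.1 fs.2} = (2 * (m + n)).choose n := by
  rw [← card_mark_eq]
  refine Nat.card_congr (Equiv.ofBijective (fun fs => ⟨fs.1.2, fs.2.card_mark⟩) ⟨?_, ?_⟩)
  · rintro ⟨⟨f, s⟩, hf⟩ ⟨⟨g, t⟩, hg⟩ h
    obtain rfl : s = t := congrArg Subtype.val h
    obtain rfl := (existsUnique_arises_of_card hf.card_mark).unique hf hg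
    rfl
  · rintro ⟨s, hs⟩
    obtain ⟨f, hf, -⟩ := existsUnique_arises_of_card (f₀ := f₀) hs
    exact ⟨⟨⟨f, s⟩, hf⟩, rfl⟩

theorem card_exists_arises (hm : 0 < m) (h₀ : ∀ p, ¬ IsShort f₀ p) (n : ℕ) :
    Nat.card {f // ∃ s, Arises f₀ n f s} = (2 * (m + n)).choose n := by
  rw [← card_arises f₀]
  refine (Nat.card_congr (Equiv.ofBijective (fun fs => ⟨fs.1.1, fs.1.2, fs.2⟩) ⟨?_, ?_⟩)).symm
  · rintro ⟨⟨f, s⟩, hf⟩ ⟨⟨g, t⟩, hg⟩ h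
    obtain rfl : f = g := congrArg Subtype.val h
    obtain rfl := hf.mark_unique hm h₀ hg
    rfl
  · rintro ⟨f, s, h⟩
    exact ⟨⟨⟨f, s⟩, h⟩, rfl⟩

/-- Removing any short chord from a diagram that arises from the empty one. -/
theorem exists_arises_removeChord {f₀ : Fin (2 * 0) → Fin (2 * 0)} : ∀ {n : ℕ}
    {f : Fin (2 * (0 + n + 1)) → Fin (2 * (0 + n + 1))} {s : Fin (2 * (0 + n + 1)) → Bool},
    Arises f₀ (n + 1) f s → ∀ {p : Fin (2 * (0 + n + 1))}, IsShort f p →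
    ∃ f' s', Arises f₀ n f' s' ∧ f = addChord p f' := by
  intro n
  induction n with
  | zero =>
    rintro f s - p hp
    exact ⟨f₀, fun _ => false, ⟨rfl, rfl⟩, eq_extend hp.1 hp.2 fun x => absurd x.2 (by omega)⟩
  | succ n ih =>
    rintro f s ⟨q, f', s', h', rfl, rfl⟩ p hp
    by_cases hqp : q = p
    · subst hqp
      exact ⟨f', s', h', rfl⟩
    obtain ⟨h1, h2⟩ := isShort_disjoint (Nat.succ_pos _) hp (isShort_addChord q f')
    obtain ⟨q', p', e1, e2, e3, e4, e5⟩ := exists_emb_comm p q hqp h1 h2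
    obtain ⟨f'', s'', h'', rfl⟩ := ih h' ((isShort_addChord_emb e3 e4 _).1 hp)
    exact ⟨_, _, h''.succ q', (addChord_comm e1 e2 e3 e4 e5 _).symm⟩

/-- If two different short chords are not oriented by the marks from the first to the second
point, then they are equal. -/
theorem Arises.reversed_unique {f₀ : Fin (2 * 0) → Fin (2 * 0)} : ∀ {n : ℕ}
    {f : Fin (2 * (0 + n + 1)) → Fin (2 * (0 + n + 1))} {s : Fin (2 * (0 + n + 1)) → Bool},
    Arises f₀ (n + 1) f s → ∀ {p q : Fin (2 * (0 + n + 1))}, IsShort f p → IsShort f q →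
    s p = true → s (nx p) = false → s q = true → s (nx q) = false → p = q := by
  intro n
  induction n with
  | zero =>
    rintro f s - p q hp hq sp sp' sq sq'
    obtain rfl | rfl | ⟨x, -⟩ := eq_or_eq_nx_or_emb q p
    · rfl
    · simp [sp] at sq'
    · exact absurd x.2 (by omega)
  | succ n ih =>
    rintro f s ⟨r, f', s', h', rfl, rfl⟩ p q hp hq sp sp' sq sq'
    -- The last inserted chord is oriented forwards by its own marks, so a reversed short chord
    -- comes from the previous diagram.
    have key : ∀ {p}, IsShort (addChord r f') p → addMark r s' p = true →
        addMark r s' (nx p) = false → ∃ p', emb r p' = p ∧ IsShort f' p' ∧ s' p' = true ∧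
          s' (nx p') = false := by
      intro p hp sp sp'
      have hrp : r ≠ p := by
        rintro rfl
        simp [addMark] at sp
      obtain ⟨h1, h2⟩ := isShort_disjoint (Nat.succ_pos _) hp (isShort_addChord r f')
      obtain ⟨-, p', -, -, e3, e4, -⟩ := exists_emb_comm p r hrp h1 h2
      refine ⟨p', e3, (isShort_addChord_emb e3 e4 _).1 hp, ?_, ?_⟩
      · simpa [addMark, ← e3] using sp
      · simpa [addMark, ← e4] using sp'
    obtain ⟨p', rfl, hp', tp, tp'⟩ := key hp sp sp'
    obtain ⟨q', rfl, hq', tq, tq'⟩ := key hq sq sq'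
    rw [ih h' hp' hq' tp tp' tq tq']

end Menage
-- Markings of diagrams that arise from the empty one.
namespace Menage
open Finset

/-- A new pair separates only the two neighbours between which it is placed. -/
theorem emb_nx_or {k : ℕ} (r : Fin (2 * (k + 1 + 1))) (x : Fin (2 * (k + 1))) :
    emb r (nx x) = nx (emb r x) ∨ nx (emb r x) = r := by
  by_contra! h
  have h1 : (emb r (nx x) : ℕ) ≠ nx (emb r x) := fun e => h.1 (Fin.ext e)
  have h2 : (nx (emb r x) : ℕ) ≠ r := fun e => h.2 (Fin.ext e)
  have := x.2
  have := r.2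
  simp only [val_emb, val_nx] at h1 h2
  split_ifs at * <;> omega

variable {f₀ : Fin (2 * 0) → Fin (2 * 0)}

/-- The inserted chord is short and separates the ends of at most one of two earlier short chords. A
single chord counts twice, once from each end. -/
theorem Arises.exists_two_short : ∀ {n : ℕ} {f : Fin (2 * (0 + n + 1)) → Fin (2 * (0 + n + 1))}
    {s : Fin (2 * (0 + n + 1)) → Bool}, Arises f₀ (n + 1) f s →
    ∃ p q, p ≠ q ∧ IsShort f p ∧ IsShort f q := by
  intro n
  induction n with
  | zero =>
    rintro f s ⟨r, f', s', -, rfl, rfl⟩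
    have h := isShort_addChord r f'
    have e : nx (nx r) = r := nx_nx_two r
    exact ⟨r, nx r, (nx_ne r).symm, h, h.2.trans e.symm, e.symm ▸ h.1⟩
  | succ n ih =>
    rintro f s ⟨r, f', s', h', rfl, rfl⟩
    obtain ⟨p, q, hpq, hp, hq⟩ := ih h'
    rcases emb_nx_or (k := 0 + n) r p with hr | hr
    · exact ⟨r, emb r p, (emb_ne r p).symm, isShort_addChord r f',
        (isShort_addChord_emb rfl hr f').2 hp⟩
    rcases emb_nx_or (k := 0 + n) r q with hr' | hr'
    · exact ⟨r, emb r q, (emb_ne r q).symm, isShort_addChord r f',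
        (isShort_addChord_emb rfl hr' f').2 hq⟩
    · exact absurd (emb_injective r (nx_injective (hr.trans hr'.symm))) hpq

/-- In a diagram that arises from the empty one, a given short chord is oriented backwards by
exactly one choice of marks. -/
theorem existsUnique_reversed : ∀ {n : ℕ} {f : Fin (2 * (0 + n + 1)) → Fin (2 * (0 + n + 1))},
    (∃ s, Arises f₀ (n + 1) f s) → ∀ {p : Fin (2 * (0 + n + 1))}, IsShort f p →
    ∃! s, Arises f₀ (n + 1) f s ∧ s p = true ∧ s (nx p) = false := by
  intro n
  induction n with
  | zero =>
    rintro f - p hp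
    have e : nx (nx p) = p := nx_nx_two p
    have hf : f = addChord (nx p) f₀ :=
      eq_extend (hp.2.trans e.symm) (e.symm ▸ hp.1) fun x => absurd x.2 (by omega)
    have h : Arises f₀ 1 f (addMark (nx p) fun _ => false) := ⟨nx p, f₀, _, ⟨rfl, rfl⟩, hf, rfl⟩
    refine ⟨_, ⟨h, ?_, by simp [addMark]⟩, fun s hs => ?_⟩
    · have : addMark (nx p) (fun _ => false) (nx (nx p)) = true := by simp [addMark]
      rwa [e] at this
    · exact eq_extend hs.2.2 (e.symm ▸ hs.2.1) fun x => absurd x.2 (by omega)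
  | succ n ih =>
    rintro f ⟨t, ht⟩ p hp
    -- A second short chord cannot be reversed as well, so every admissible marking orients it
    -- forwards and it can be stripped off.
    obtain ⟨q, hqp, hq⟩ : ∃ q, q ≠ p ∧ IsShort f q := by
      obtain ⟨a, b, hab, ha, hb⟩ := ht.exists_two_short
      by_cases h : a = p
      · exact ⟨b, fun e => hab (h.trans e.symm), hb⟩
      · exact ⟨a, h, ha⟩
    obtain ⟨f', t', h', rfl⟩ := exists_arises_removeChord ht hq
    obtain ⟨h1, h2⟩ := isShort_disjoint (Nat.succ_pos _) hp hq
    obtain ⟨-, p', -, -, e3, e4, -⟩ := exists_emb_comm p q hqp h1 h2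
    obtain ⟨s, ⟨hs, sp, sp'⟩, hu⟩ := ih ⟨t', h'⟩ ((isShort_addChord_emb e3 e4 _).1 hp)
    refine ⟨addMark q s, ⟨hs.succ q, ?_, ?_⟩, ?_⟩
    · simpa [← e3, addMark] using sp
    · simpa [← e4, addMark] using sp'
    · rintro u ⟨hu', up, up'⟩
      have hf : u q = false ∧ u (nx q) = true := by
        refine (hu'.mark_of_isShort (fun x => absurd x.2 (by omega)) hq).resolve_right ?_
        rintro ⟨-, uq, uq'⟩
        exact hqp (hu'.reversed_unique hq hp uq uq' up up')
      obtain ⟨g, v, hv, hg, rfl⟩ := hu'.of_mark hf.1 hf.2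
      obtain rfl := addChord_injective q hg
      rw [hu v ⟨hv, by simpa [← e3, addMark] using up, by simpa [← e4, addMark] using up'⟩]

theorem addMark_injective {k : ℕ} (p : Fin (2 * (k + 1))) : Function.Injective (addMark p) :=
  extend_injective

/-- A diagram with `n` chords that arises from the empty one has `n + 1` choices of marks. -/
theorem ncard_marks : ∀ {n : ℕ} {f : Fin (2 * (0 + n)) → Fin (2 * (0 + n))},
    (∃ s, Arises f₀ n f s) → {s | Arises f₀ n f s}.ncard = n + 1 := by
  intro n
  induction n with
  | zero =>
    rintro f ⟨s, hs⟩
    refine Set.ncard_eq_one.2 ⟨s, Set.eq_singleton_iff_unique_mem.2 ⟨hs, fun t ht => ?_⟩⟩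
    exact ht.2.trans hs.2.symm
  | succ n ih =>
    rintro f ⟨s, hs⟩
    obtain ⟨p, f', s', h', hf, -⟩ := id hs
    have hp : IsShort f p := hf ▸ isShort_addChord p f'
    obtain ⟨r, ⟨hr, rp, rp'⟩, hu⟩ := existsUnique_reversed ⟨s, hs⟩ hp
    -- Markings orienting the short chord at `p` forwards come from `f'`; exactly one orients it
    -- backwards.
    have hset : {s | Arises f₀ (n + 1) f s} = insert r (addMark p '' {s | Arises f₀ n f' s}) := by
      ext t
      constructor
      · intro ht
        obtain ⟨h1, h2⟩ | ⟨-, h1, h2⟩ :=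
          ht.mark_of_isShort (fun x => absurd x.2 (by omega)) hp
        · obtain ⟨g, u, hu', hg, rfl⟩ := ht.of_mark h1 h2
          obtain rfl := addChord_injective p (hf.symm.trans hg)
          exact Or.inr ⟨u, hu', rfl⟩
        · exact Or.inl (hu t ⟨ht, h1, h2⟩)
      · rintro (rfl | ⟨u, hu', rfl⟩)
        · exact hr
        · exact hf ▸ Arises.succ hu' p
    rw [hset, Set.ncard_insert_of_notMem, Set.ncard_image_of_injective _ (addMark_injective p),
      ih ⟨s', h'⟩]
    rintro ⟨u, -, rfl⟩
    simp [addMark] at rp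

theorem card_exists_arises_empty (n : ℕ) :
    Nat.card {f // ∃ s, Arises f₀ n f s} = catalan n := by
  have h := card_arises f₀ n
  let e : {fs : (Fin (2 * (0 + n)) → Fin (2 * (0 + n))) × (Fin (2 * (0 + n)) → Bool) //
      Arises f₀ n fs.1 fs.2} ≃ Σ f : {f // ∃ s, Arises f₀ n f s}, {s | Arises f₀ n f.1 s} :=
    { toFun := fun x => ⟨⟨x.1.1, x.1.2, x.2⟩, x.1.2, x.2⟩
      invFun := fun y => ⟨⟨y.1.1, y.2.1⟩, y.2.2⟩
      left_inv := fun _ => rfl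
      right_inv := fun _ => rfl }
  have := Fintype.ofFinite {f // ∃ s, Arises f₀ n f s}
  rw [Nat.card_congr e, Nat.card_sigma] at h
  have h1 : ∀ f : {f // ∃ s, Arises f₀ n f s}, Nat.card {s | Arises f₀ n f.1 s} = n + 1 :=
    fun f => ncard_marks f.2
  simp only [h1, sum_const, smul_eq_mul, card_univ, ← Nat.card_eq_fintype_card, zero_add] at h
  rw [← Nat.centralBinom_eq_two_mul_choose, ← succ_mul_catalan_eq_centralBinom, mul_comm] at h
  exact Nat.eq_of_mul_eq_mul_left (Nat.succ_pos n) h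

end Menage
-- Permutations as chord diagrams, reductions as removals of short chords.
namespace Menage

/-- The chord diagram of a permutation of `Fin N` on `2N` points: the point `j` is split into the
end `2j` of its incoming arc and the start `2j + 1` of its outgoing arc. -/
def diagram {N : ℕ} (τ : Equiv.Perm (Fin N)) (x : Fin (2 * N)) : Fin (2 * N) :=
  if (x : ℕ) % 2 = 0 then ⟨2 * τ.symm ⟨x / 2, by omega⟩ + 1, by omega⟩
  else ⟨2 * τ ⟨x / 2, by omega⟩, by omega⟩

/-- The start of the outgoing arc of `j`. -/
def outPt {N : ℕ} (j : Fin N) : Fin (2 * N) := ⟨2 * j + 1, by omega⟩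

/-- The end of the incoming arc of `j`. -/
def inPt {N : ℕ} (j : Fin N) : Fin (2 * N) := ⟨2 * j, by omega⟩

theorem val_outPt {N : ℕ} (j : Fin N) : (outPt j : ℕ) = 2 * j + 1 := rfl

theorem val_inPt {N : ℕ} (j : Fin N) : (inPt j : ℕ) = 2 * j := rfl

theorem eq_inPt_or_eq_outPt {N : ℕ} (x : Fin (2 * N)) : ∃ j, x = inPt j ∨ x = outPt j := by
  have := x.2
  refine ⟨⟨x / 2, by omega⟩, ?_⟩
  rcases Nat.mod_two_eq_zero_or_one x with h | h
  · left
    ext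
    simp only [inPt]
    omega
  · right
    ext
    simp only [outPt]
    omega

variable {N : ℕ} (τ : Equiv.Perm (Fin N))

@[simp] theorem diagram_outPt (j : Fin N) : diagram τ (outPt j) = inPt (τ j) := by
  have h' : (2 * (j : ℕ) + 1) / 2 = j := by omega
  ext
  simp [diagram, outPt, inPt, h']

@[simp] theorem diagram_inPt (j : Fin N) : diagram τ (inPt j) = outPt (τ.symm j) := by
  ext
  simp [diagram, outPt, inPt]

theorem inPt_injective : Function.Injective (inPt : Fin N → _) := by
  intro i j h
  have := congrArg Fin.val h
  simp only [inPt] at this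
  ext
  omega

theorem outPt_injective : Function.Injective (outPt : Fin N → _) := by
  intro i j h
  have := congrArg Fin.val h
  simp only [outPt] at this
  ext
  omega

theorem diagram_involutive : Function.Involutive (diagram τ) := by
  intro x
  obtain ⟨j, rfl | rfl⟩ := eq_inPt_or_eq_outPt x <;> simp

theorem diagram_injective : Function.Injective (diagram : Equiv.Perm (Fin N) → _) := by
  intro σ τ h
  ext1 j
  exact inPt_injective (by simpa using congrFun h (outPt j))

theorem exists_diagram_eq {f : Fin (2 * N) → Fin (2 * N)} (h : Function.Involutive f)
    (h' : ∀ x, ((f x : ℕ) + x) % 2 = 1) : ∃ τ, diagram τ = f := by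
  have ho : ∀ j, ∃ i, f (outPt j) = inPt i := fun j => by
    obtain ⟨i, hi | hi⟩ := eq_inPt_or_eq_outPt (f (outPt j))
    · exact ⟨i, hi⟩
    · have := h' (outPt j)
      rw [hi] at this
      simp only [outPt] at this
      omega
  have hi : ∀ j, ∃ i, f (inPt j) = outPt i := fun j => by
    obtain ⟨i, hi | hi⟩ := eq_inPt_or_eq_outPt (f (inPt j))
    · have := h' (inPt j)
      rw [hi] at this
      simp only [inPt] at this
      omega
    · exact ⟨i, hi⟩
  choose a ha using ho
  choose b hb using hi
  refine ⟨⟨a, b, fun j => ?_, fun j => ?_⟩, funext fun x => ?_⟩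
  · exact outPt_injective (by rw [← hb, ← ha, h])
  · exact inPt_injective (by rw [← ha, ← hb, h])
  · obtain ⟨j, rfl | rfl⟩ := eq_inPt_or_eq_outPt x
    · rw [diagram_inPt, hb]
      rfl
    · rw [diagram_outPt, ha]
      rfl

theorem diagram_parity (x : Fin (2 * N)) : ((diagram τ x : ℕ) + x) % 2 = 1 := by
  obtain ⟨j, rfl | rfl⟩ := eq_inPt_or_eq_outPt x
  · rw [diagram_inPt, val_inPt, val_outPt]
    omega
  · rw [diagram_outPt, val_inPt, val_outPt]
    omega

/-- Adjacent points have opposite parity and `emb p` preserves parity, even in the wrap-around case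
where `0` moves to `2 * k`. -/
theorem exists_diagram_eq_addChord {k : ℕ} (p : Fin (2 * (k + 1))) (τ : Equiv.Perm (Fin k)) :
    ∃ σ, diagram σ = addChord p (diagram τ) := by
  have hp : ((nx p : ℕ) + p) % 2 = 1 := by
    rw [val_nx]
    split_ifs <;> omega
  have he : ∀ x : Fin (2 * k), (emb p x : ℕ) % 2 = (x : ℕ) % 2 := fun x => by
    rw [val_emb]
    split_ifs <;> omega
  refine exists_diagram_eq (fun y => ?_) fun y => ?_
  · obtain rfl | rfl | ⟨x, rfl⟩ := eq_or_eq_nx_or_emb p y <;>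
      simp [addChord, diagram_involutive τ _]
  · obtain rfl | rfl | ⟨x, rfl⟩ := eq_or_eq_nx_or_emb p y
    · simpa [addChord] using hp
    · simpa [addChord, add_comm] using hp
    · have := diagram_parity τ x
      have := he x
      have := he (diagram τ x)
      simp only [addChord, extend_emb]
      omega

theorem diagram_eq_addChord_iff {k : ℕ} (σ : Equiv.Perm (Fin (k + 1))) (τ : Equiv.Perm (Fin k))
    (p : Fin (2 * (k + 1))) : diagram σ = addChord p (diagram τ) ↔
      IsShort (diagram σ) p ∧ ∀ j, diagram σ (emb p (outPt j)) = emb p (inPt (τ j)) := by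
  constructor
  · intro h
    rw [h]
    exact ⟨isShort_addChord _ _, fun j => by simp [addChord]⟩
  · rintro ⟨⟨h1, h2⟩, h⟩
    refine eq_extend h1 h2 fun x => ?_
    obtain ⟨j, rfl | rfl⟩ := eq_inPt_or_eq_outPt x
    · rw [diagram_inPt, (diagram_involutive σ).eq_iff, h, Equiv.apply_symm_apply]
    · rw [diagram_outPt, h]

theorem isShort_diagram_iff {σ : Equiv.Perm (Fin N)} {p : Fin (2 * N)} :
    IsShort (diagram σ) p ↔ diagram σ p = nx p :=
  ⟨fun h => h.1, fun h => ⟨h, by rw [← h, diagram_involutive]⟩⟩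

theorem isShort_inPt_iff {σ : Equiv.Perm (Fin N)} {i : Fin N} :
    IsShort (diagram σ) (inPt i) ↔ σ i = i := by
  have h : nx (inPt i) = outPt i := by
    ext
    rw [val_nx]
    exact if_neg (by simp [inPt]; omega)
  rw [isShort_diagram_iff, h, diagram_inPt, outPt_injective.eq_iff, Equiv.symm_apply_eq, eq_comm]

theorem isShort_outPt_iff {σ : Equiv.Perm (Fin N)} {i : Fin N} :
    IsShort (diagram σ) (outPt i) ↔ IsGenSucc σ i := by
  rw [isShort_diagram_iff, diagram_outPt, IsGenSucc, Fin.ext_iff, val_nx, val_inPt, val_outPt,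
    Nat.ModEq, Nat.mod_eq_of_lt (σ i).2]
  have := i.2
  by_cases h : (i : ℕ) + 1 = N
  · rw [h, Nat.mod_self, if_pos (by omega)]
    omega
  · rw [Nat.mod_eq_of_lt (by omega), if_neg (by omega)]
    omega

theorem val_succAbove {k : ℕ} (i : Fin (k + 1)) (j : Fin k) :
    (i.succAbove j : ℕ) = if (j : ℕ) < i then (j : ℕ) else j + 1 := by
  rw [Fin.succAbove]
  split_ifs with h h' h' <;> simp [Fin.lt_def] at h <;> simp <;> omega

theorem isRemoveFixedPoint_iff {k : ℕ} (σ : Equiv.Perm (Fin (k + 1))) (i : Fin (k + 1))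
    (τ : Equiv.Perm (Fin k)) :
    IsRemoveFixedPoint σ i τ ↔ diagram σ = addChord (inPt i) (diagram τ) := by
  rw [diagram_eq_addChord_iff, isShort_inPt_iff, IsRemoveFixedPoint]
  refine and_congr_right fun hi => forall_congr' fun j => ?_
  have e : emb (inPt i) (outPt j) = outPt (i.succAbove j) := by
    ext
    rw [val_emb, val_outPt, val_outPt, val_inPt, val_succAbove]
    split_ifs <;> omega
  -- The value `i` is already taken at the fixed point, so `removeLabel` is never applied to `i`
  -- itself.
  have hne : (σ (i.succAbove j) : ℕ) ≠ i := fun h =>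
    Fin.succAbove_ne i j (σ.injective ((Fin.ext h).trans hi.symm))
  rw [e, diagram_outPt, Fin.ext_iff, val_emb, removeLabel, val_inPt, val_inPt, val_inPt]
  split_ifs <;> omega

theorem isGlueGenSucc_iff {k : ℕ} (σ : Equiv.Perm (Fin (k + 1))) (i : Fin (k + 1))
    (τ : Equiv.Perm (Fin k)) :
    IsGlueGenSucc σ i τ ↔ diagram σ = addChord (outPt i) (diagram τ) := by
  rw [diagram_eq_addChord_iff, isShort_outPt_iff, IsGlueGenSucc]
  refine and_congr_right fun hi => forall_congr' fun j => ?_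
  have e : emb (outPt i) (outPt j) = outPt (i.succAbove j) := by
    ext
    have := j.2
    rw [val_emb, val_outPt, val_outPt, val_outPt, val_succAbove]
    split_ifs <;> first | contradiction | omega
  have hne : (σ (i.succAbove j) : ℕ) ≠ σ i := fun h =>
    Fin.succAbove_ne i j (σ.injective (Fin.ext h))
  have hi' : (σ i : ℕ) = if (i : ℕ) = k then 0 else (i : ℕ) + 1 := by
    rw [IsGenSucc, Nat.ModEq, Nat.mod_eq_of_lt (σ i).2] at hi
    rw [hi]
    split_ifs with h
    · rw [h, Nat.mod_self]
    · exact Nat.mod_eq_of_lt (by omega)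
  rw [hi'] at hne
  have := (σ (i.succAbove j)).2
  rw [e, diagram_outPt, Fin.ext_iff, val_emb, glueLabel, val_inPt, val_inPt, val_outPt]
  split_ifs at * <;> omega

/-- A short chord starting at an `inPt` is a fixed point, one starting at an `outPt` a generalized
succession. -/
theorem step_iff {k : ℕ} (σ : Equiv.Perm (Fin (k + 1))) (τ : Equiv.Perm (Fin k)) :
    Step ⟨k + 1, σ⟩ ⟨k, τ⟩ ↔ ∃ p, diagram σ = addChord p (diagram τ) := by
  constructor
  · rintro (⟨_, i, _, h⟩ | ⟨_, i, _, h⟩)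
    · exact ⟨_, (isRemoveFixedPoint_iff σ i τ).1 h⟩
    · exact ⟨_, (isGlueGenSucc_iff σ i τ).1 h⟩
  · rintro ⟨p, h⟩
    obtain ⟨i, rfl | rfl⟩ := eq_inPt_or_eq_outPt p
    · exact .removeFixedPoint σ i τ ((isRemoveFixedPoint_iff σ i τ).2 h)
    · exact .glueGenSucc σ i τ ((isGlueGenSucc_iff σ i τ).2 h)

variable {m : ℕ} {π : Equiv.Perm (Fin m)}

theorem Arises.exists_canReduce : ∀ {n : ℕ} {f : Fin (2 * (m + n)) → Fin (2 * (m + n))}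
    {s : Fin (2 * (m + n)) → Bool}, Arises (diagram π) n f s →
    ∃ τ : Equiv.Perm (Fin (m + n)), diagram τ = f ∧ CanReduce τ π
  | 0, f, s, h => ⟨π, h.1.symm, .refl⟩
  | n + 1, f, s, ⟨p, f', s', h', hf, hs⟩ => by
    obtain ⟨τ, rfl, hτ⟩ := h'.exists_canReduce
    obtain ⟨σ, hσ⟩ := exists_diagram_eq_addChord p τ
    exact ⟨σ, hσ.trans hf.symm, .head ((step_iff σ τ).2 ⟨p, hσ⟩) hτ⟩

theorem exists_arises_of_reflTransGen {x : Σ n, Equiv.Perm (Fin n)}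
    (h : Relation.ReflTransGen Step x ⟨m, π⟩) :
    ∃ (n : ℕ) (τ : Equiv.Perm (Fin (m + n))), x = ⟨m + n, τ⟩ ∧
      ∃ s, Arises (diagram π) n (diagram τ) s := by
  induction h using Relation.ReflTransGen.head_induction_on with
  | refl => exact ⟨0, π, rfl, _, rfl, rfl⟩
  | @head x y hxy _ ih =>
    obtain ⟨n, τ, rfl, s, hs⟩ := ih
    obtain ⟨σ, rfl⟩ : ∃ σ : Equiv.Perm (Fin (m + n + 1)), x = ⟨m + n + 1, σ⟩ := by
      rcases hxy with ⟨σ, _, _, _⟩ | ⟨σ, _, _, _⟩ <;> exact ⟨σ, rfl⟩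
    obtain ⟨p, hp⟩ := (step_iff σ τ).1 hxy
    refine ⟨n + 1, σ, rfl, addMark p s, ?_⟩
    have := hs.succ p
    rwa [← hp] at this

theorem canReduce_iff {n : ℕ} {τ : Equiv.Perm (Fin (m + n))} :
    CanReduce τ π ↔ ∃ s, Arises (diagram π) n (diagram τ) s := by
  constructor
  · intro h
    obtain ⟨n', τ', he, hs⟩ := exists_arises_of_reflTransGen h
    obtain rfl : n = n' := Nat.add_left_cancel (congrArg Sigma.fst he)
    obtain rfl : τ = τ' := by simpa using he
    exact hs
  · rintro ⟨s, hs⟩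
    obtain ⟨σ, hσ, h⟩ := hs.exists_canReduce
    exact diagram_injective hσ ▸ h

theorem reductionCount_eq (π : Equiv.Perm (Fin m)) (n : ℕ) :
    reductionCount π n = Nat.card {f // ∃ s, Arises (diagram π) n f s} := by
  refine Nat.card_congr (Equiv.ofBijective
    (fun τ => ⟨diagram τ.1, canReduce_iff.1 τ.2⟩) ⟨?_, ?_⟩)
  · intro σ τ h
    exact Subtype.ext (diagram_injective (congrArg Subtype.val h))
  · rintro ⟨f, s, hs⟩
    obtain ⟨τ, rfl, h⟩ := hs.exists_canReduce
    exact ⟨⟨τ, h⟩, rfl⟩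

theorem IsOrdinaryMenage.not_isShort (hπ : IsOrdinaryMenage π) (p : Fin (2 * m)) :
    ¬ IsShort (diagram π) p := by
  obtain ⟨i, rfl | rfl⟩ := eq_inPt_or_eq_outPt p
  · exact isShort_inPt_iff.not.2 (hπ i).1
  · exact isShort_outPt_iff.not.2 (hπ i).2

end Menage
-- Generating series of the binomial coefficients.
namespace Menage
open PowerSeries

/-- The generating series of the binomial coefficients `(a + 2n).choose n`. -/
noncomputable def chooseSeries (a : ℕ) : PowerSeries ℕ := mk fun n => (a + 2 * n).choose n

theorem chooseSeries_succ (a : ℕ) :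
    chooseSeries (a + 1) = chooseSeries a + X * chooseSeries (a + 2) := by
  ext n
  cases n with
  | zero => simp [chooseSeries]
  | succ n =>
    rw [map_add, coeff_succ_X_mul]
    simp only [chooseSeries, coeff_mk]
    rw [show a + 1 + 2 * (n + 1) = a + 2 + 2 * n + 1 by ring, Nat.choose_succ_succ, add_comm,
      show a + 2 * (n + 1) = a + 2 + 2 * n by ring]

theorem chooseSeries_one :
    chooseSeries 1 = catalanSeries + 2 * X * derivative ℕ catalanSeries := by
  have key : ∀ n, (1 + 2 * n).choose n = (2 * n + 1) * catalan n := fun n => by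
    have h := Nat.add_one_mul_choose_eq (2 * n) n
    rw [← Nat.centralBinom_eq_two_mul_choose, ← succ_mul_catalan_eq_centralBinom,
      Nat.choose_symm_half, mul_left_comm, mul_comm _ (n + 1)] at h
    rw [add_comm]
    exact (Nat.eq_of_mul_eq_mul_left (Nat.succ_pos n) h).symm
  ext n
  rw [map_add, mul_assoc, show (2 : PowerSeries ℕ) = C 2 from rfl, coeff_C_mul]
  cases n with
  | zero => simp [chooseSeries]
  | succ n =>
    rw [coeff_succ_X_mul, coeff_derivative]
    simp only [chooseSeries, coeff_mk, catalanSeries_coeff, key]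
    push_cast
    ring

/-- Differentiating `c = x c² + 1` gives `c' = c (c + 2 x c')`. -/
theorem derivative_catalanSeries :
    derivative ℕ catalanSeries = catalanSeries * chooseSeries 1 := by
  have h := congrArg (derivative ℕ) catalanSeries_sq_mul_X_add_one
  rw [map_add, Derivation.leibniz, derivative_one, derivative_pow, derivative_X] at h
  rw [chooseSeries_one]
  conv_lhs => rw [← h]
  simp only [smul_eq_mul, Nat.cast_ofNat]
  ring

theorem chooseSeries_two : chooseSeries 2 = derivative ℕ catalanSeries := by
  ext n
  rw [coeff_derivative, catalanSeries_coeff, chooseSeries, coeff_mk]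
  have h := Nat.choose_succ_right_eq (2 * (n + 1)) n
  rw [← Nat.centralBinom_eq_two_mul_choose, ← succ_mul_catalan_eq_centralBinom,
    show 2 * (n + 1) - n = n + 2 by omega, mul_comm _ (n + 2), mul_assoc] at h
  rw [show 2 + 2 * n = 2 * (n + 1) by ring]
  exact_mod_cast (Nat.eq_of_mul_eq_mul_left (Nat.succ_pos (n + 1)) h).symm

theorem chooseSeries_add_two (a : ℕ) :
    chooseSeries (a + 2) = catalanSeries * chooseSeries (a + 1) := by
  induction a with
  | zero => rw [chooseSeries_two, derivative_catalanSeries]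
  | succ a ih =>
    have h := chooseSeries_succ (a + 1)
    rw [show a + 1 + 1 = a + 2 from rfl, ih] at h
    have h1 : catalanSeries * chooseSeries (a + 1) =
        chooseSeries (a + 1) + X * (catalanSeries * chooseSeries (a + 2)) := by
      conv_lhs => rw [← catalanSeries_sq_mul_X_add_one]
      rw [ih]
      ring
    -- Two expansions of `c B_{a+1}` share the summand `B_{a+1}`; over `ℕ` it is cancelled
    -- coefficientwise, then the factor `X`.
    refine X_mul_cancel (PowerSeries.ext fun n => ?_)
    have h2 := congrArg (coeff n) (h.symm.trans h1)
    rw [map_add, map_add] at h2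
    exact Nat.add_left_cancel h2

theorem chooseSeries_two_mul (m : ℕ) :
    chooseSeries (2 * (m + 1)) = derivative ℕ catalanSeries * catalanSeries ^ (2 * m) := by
  induction m with
  | zero => simp [chooseSeries_two]
  | succ m ih =>
    rw [show 2 * (m + 1 + 1) = 2 * m + 2 + 2 by ring, chooseSeries_add_two,
      show 2 * m + 2 + 1 = 2 * m + 1 + 2 by ring, chooseSeries_add_two,
      show 2 * m + 1 + 1 = 2 * (m + 1) by ring, ih]
    ring

end Menage
theorem mainTheorem4 {m : ℕ} (π : Equiv.Perm (Fin m)) (hπ : Menage.IsOrdinaryMenage π) :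
    PowerSeries.mk (fun n => Menage.reductionCount π n) =
      if 0 < m then
        PowerSeries.derivative ℕ PowerSeries.catalanSeries *
          PowerSeries.catalanSeries ^ (2 * m - 2)
      else PowerSeries.catalanSeries := by
  rcases m with _ | m
  · rw [if_neg (lt_irrefl 0), PowerSeries.catalanSeries]
    congr 1
    funext n
    rw [Menage.reductionCount_eq, Menage.card_exists_arises_empty]
  · rw [if_pos m.succ_pos, show 2 * (m + 1) - 2 = 2 * m by omega, ← Menage.chooseSeries_two_mul,
      Menage.chooseSeries]
    congr 1
    funext n
    rw [Menage.reductionCount_eq, Menage.card_exists_arises m.succ_pos hπ.not_isShort, mul_add]
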